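/- Let $\mathcal H$ be a separable complex Hilbert space and let $\mathfrak S(\mathcal H)$ be the set of states on $\mathcal H$, i.e. of positive trace-class operators $\rho$ on $\mathcal H$ with $\operatorname{Tr}\rho=1$. For a state $\rho$ let $\{\lambda^\rho_i\}_{i\ge 1}$ be the non-increasing sequence of its eigenvalues, taking multiplicity into account (completed by zeros if $\rho$ has finite rank). The state $\rho$ has the FA-property if there is a sequence $\{g_i\}_{i\ge1}$ of nonnegative numbers such that $$\sum_{i=1}^{+\infty}\lambda^\rho_i g_i<+\infty\quad\text{and}\quad \lim_{\beta\to0^+}\Big[\sum_{i=1}^{+\infty}e^{-\beta g_i}\Big]^{\beta}=1 .$$ Let $\mathfrak S_{\mathsf{FA}}(\mathcal H)$ be the set of all states on $\mathcal H$ that have the FA-property. Then $\mathfrak S_{\mathsf{FA}}(\mathcal H)$ is a dense face of the convex set $\mathfrak S(\mathcal H)$, i.e. (a) $\mathfrak S_{\mathsf{FA}}(\mathcal H)$ is a convex subset of $\mathfrak S(\mathcal H)$, and it contains every line segment $[\rho_1,\rho_2]$ with $\rho_1,\rho_2\in\mathfrak S(\mathcal H)$ that has at least one internal point belonging to $\mathfrak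 S_{\mathsf{FA}}(\mathcal H)$; (b) $\mathfrak S_{\mathsf{FA}}(\mathcal H)$ is dense in $\mathfrak S(\mathcal H)$ with respect to the trace norm $\|A\|_1=\operatorname{Tr}\sqrt{A^*A}$. -/

import Mathlib

open Filter Topology
open scoped ENNReal

noncomputable section

namespace QuantumState

variable {H : Type*} [NormedAddCommGroup H] [InnerProductSpace ℂ H] [CompleteSpace H]

/-- The index set of a fixed orthonormal (Hilbert) basis of `H`. -/
def basisIndex (H : Type*) [NormedAddCommGroup H] [InnerProductSpace ℂ H] [CompleteSpace H] :
    Set H :=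
  (exists_hilbertBasis ℂ H).choose

/-- A fixed orthonormal (Hilbert) basis of `H`, used to compute traces
(which do not depend on this choice). -/
def onb (H : Type*) [NormedAddCommGroup H] [InnerProductSpace ℂ H] [CompleteSpace H] :
    HilbertBasis (basisIndex H) ℂ H :=
  (exists_hilbertBasis ℂ H).choose_spec.choose

/-- The trace norm `‖A‖₁ = Tr |A| ∈ [0, ∞]`, where `|A| = √(A* A)`. -/
def traceNorm (A : H →L[ℂ] H) : ℝ≥0∞ :=
  ∑' i, ENNReal.ofReal (inner ℂ (onb H i) (CFC.abs A (onb H i))).re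

/-- Trace-class operators: those with finite trace norm. -/
def IsTraceClass (A : H →L[ℂ] H) : Prop :=
  traceNorm A < ∞

/-- The trace of a (trace-class) operator. -/
def trace (A : H →L[ℂ] H) : ℂ :=
  ∑' i, inner ℂ (onb H i) (A (onb H i))

/-- The set `𝔖(H)` of states: positive trace-class operators with unit trace. -/
def states (H : Type*) [NormedAddCommGroup H] [InnerProductSpace ℂ H] [CompleteSpace H] :
    Set (H →L[ℂ] H) :=
  {ρ | ρ.IsPositive ∧ IsTraceClass ρ ∧ trace ρ = 1}

/-- The number of eigenvalues of `ρ` in `[μ, ∞)`, counted with multiplicity: the dimension of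
the span of the corresponding eigenspaces (which are linearly independent). -/
def countEigenvaluesGE (ρ : H →L[ℂ] H) (μ : ℝ) : Cardinal :=
  Module.rank ℂ
    (⨆ (ν : ℝ) (_ : μ ≤ ν), Module.End.eigenspace (ρ : H →ₗ[ℂ] H) (ν : ℂ) : Submodule ℂ H)

/-- The non-increasing sequence of eigenvalues of a positive trace-class operator, with
multiplicity: `eigenvalueSeq ρ n` is the `(n+1)`-st largest eigenvalue, i.e. the largest `μ > 0`
such that at least `n + 1` eigenvalues are `≥ μ`; it is `0` (the value of the supremum of the
empty set) if there are at most `n` positive eigenvalues. -/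
def eigenvalueSeq (ρ : H →L[ℂ] H) (n : ℕ) : ℝ :=
  sSup {μ : ℝ | 0 < μ ∧ (n : Cardinal) < countEigenvaluesGE ρ μ}

/-- The FA-property. The sum of exponentials is taken in `[0, ∞]`. -/
def HasFAProperty (ρ : H →L[ℂ] H) : Prop :=
  ∃ g : ℕ → ℝ, (∀ i, 0 ≤ g i) ∧
    Summable (fun i => eigenvalueSeq ρ i * g i) ∧
    Tendsto (fun β : ℝ => (∑' i, ENNReal.ofReal (Real.exp (-β * g i))) ^ β) (𝓝[>] 0) (𝓝 1)

/-- The set of states with the FA-property. -/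
def statesFA (H : Type*) [NormedAddCommGroup H] [InnerProductSpace ℂ H] [CompleteSpace H] :
    Set (H →L[ℂ] H) :=
  {ρ | ρ ∈ states H ∧ HasFAProperty ρ}

/-- `B` is a face of the convex set `A`: a convex subset of `A` that contains any line segment
from `A` having at least one internal point in `B`. -/
structure IsFace {E : Type*} [AddCommGroup E] [Module ℝ E] (A B : Set E) : Prop where
  convex_ambient : Convex ℝ A
  subset : B ⊆ A
  convex : Convex ℝ B
  segment_subset : ∀ x ∈ A, ∀ y ∈ A, (openSegment ℝ x y ∩ B).Nonempty → segment ℝ x y ⊆ B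

/-- `B` is a dense subset of `A` with respect to the trace norm distance `‖ρ - σ‖₁`. -/
def IsTraceNormDense (A B : Set (H →L[ℂ] H)) : Prop :=
  B ⊆ A ∧ ∀ ρ ∈ A, ∀ ε : ℝ≥0∞, 0 < ε → ∃ σ ∈ B, traceNorm (ρ - σ) < ε

end QuantumState

end

open Filter Topology
open scoped ENNReal

noncomputable section

set_option linter.unusedSectionVars false

namespace QuantumState

variable {H : Type*} [NormedAddCommGroup H] [InnerProductSpace ℂ H] [CompleteSpace H]

/-! Write `λ_n` for `eigenvalueSeq · n`. Everything about faces follows from Weyl's inequality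
`eigenvalueSeq_le_of_form_le`: for `z = a x + b y` it gives `λ_k(z) ≤ a λ_{k/2}(x) + b λ_{k/2}(y)`.
If `g`, `g'` witness the FA-property of `x`, `y`, then `k ↦ min (g (k/2)) (g' (k/2))` witnesses it
for `z`: the exponential sum grows by a factor of at most 4, and `4^β → 1`. Conversely `a x ≤ z`
with `a > 0` gives `λ_k(x) ≤ a⁻¹ λ_k(z)`, so the witness of an internal point serves both endpoints,
and convexity fills in the segment.

Density: finite-rank states have the FA-property with `g i = i`, and the normalised truncation `(ρ -
c)⁺` has finite rank and tends to `ρ` in trace norm as `c → 0`.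

Weyl's inequality rests on `topSpace A c`: the form of `A` is at least `c‖x‖²` on it and at most
`c‖x‖²` on its orthogonal complement. -/

/-! ### Quadratic forms, traces and the convex set of states. -/

/-- The real quadratic form of an operator. -/
def form (A : H →L[ℂ] H) (x : H) : ℝ := (inner ℂ x (A x)).re

/-- The sum of the diagonal entries, in `[0, ∞]`; for positive operators this is the trace. -/
def diagSum (A : H →L[ℂ] H) : ℝ≥0∞ := ∑' i, ENNReal.ofReal (form A (onb H i))

lemma form_add (A B : H →L[ℂ] H) (x : H) : form (A + B) x = form A x + form B x := by
  simp [form]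

lemma form_sub (A B : H →L[ℂ] H) (x : H) : form (A - B) x = form A x - form B x := by
  simp [form]

lemma form_smul (c : ℝ) (A : H →L[ℂ] H) (x : H) : form (c • A) x = c * form A x := by
  simp [form, inner_smul_right_eq_smul]

lemma form_algebraMap (c : ℝ) (x : H) : form (algebraMap ℝ (H →L[ℂ] H) c) x = c * ‖x‖ ^ 2 := by
  rw [Algebra.algebraMap_eq_smul_one, form_smul]
  congr 1
  simp only [form, one_apply_eq_self]
  exact inner_self_eq_norm_sq (𝕜 := ℂ) x

lemma form_nonneg {A : H →L[ℂ] H} (hA : 0 ≤ A) (x : H) : 0 ≤ form A x :=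
  ((ContinuousLinearMap.nonneg_iff_isPositive A).1 hA).re_inner_nonneg_right x

lemma form_mono {A B : H →L[ℂ] H} (h : A ≤ B) (x : H) : form A x ≤ form B x := by
  have := form_nonneg (sub_nonneg.2 h) x
  rw [form_sub] at this
  linarith

lemma form_mul_self {S : H →L[ℂ] H} (hS : IsSelfAdjoint S) (x : H) :
    form (S * S) x = ‖S x‖ ^ 2 := by
  have h := (ContinuousLinearMap.isSelfAdjoint_iff_isSymmetric.1 hS) x (S x)
  simp only [ContinuousLinearMap.coe_coe] at h
  rw [form, mul_apply_eq_comp, ← h]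
  exact inner_self_eq_norm_sq (𝕜 := ℂ) (S x)

lemma diagSum_add {A B : H →L[ℂ] H} (hA : 0 ≤ A) (hB : 0 ≤ B) :
    diagSum (A + B) = diagSum A + diagSum B := by
  simp only [diagSum, form_add]
  rw [← ENNReal.tsum_add]
  exact tsum_congr fun _ => ENNReal.ofReal_add (form_nonneg hA _) (form_nonneg hB _)

lemma diagSum_smul {c : ℝ} (hc : 0 ≤ c) (A : H →L[ℂ] H) :
    diagSum (c • A) = ENNReal.ofReal c * diagSum A := by
  simp only [diagSum, form_smul, ENNReal.ofReal_mul hc, ENNReal.tsum_mul_left]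

lemma diagSum_mono {A B : H →L[ℂ] H} (h : A ≤ B) : diagSum A ≤ diagSum B :=
  ENNReal.tsum_le_tsum fun _ => ENNReal.ofReal_le_ofReal (form_mono h _)

lemma traceNorm_eq_diagSum_abs (A : H →L[ℂ] H) : traceNorm A = diagSum (CFC.abs A) := rfl

lemma traceNorm_of_nonneg {A : H →L[ℂ] H} (hA : 0 ≤ A) : traceNorm A = diagSum A := by
  rw [traceNorm_eq_diagSum_abs, CFC.abs_of_nonneg A hA]

lemma trace_of_nonneg {A : H →L[ℂ] H} (hA : 0 ≤ A) :
    trace A = ((diagSum A).toReal : ℂ) := by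
  have hterm : ∀ i, inner ℂ (onb H i) (A (onb H i)) = ((form A (onb H i) : ℝ) : ℂ) := by
    intro i
    have h0 := ((ContinuousLinearMap.nonneg_iff_isPositive A).1 hA).inner_nonneg_right (onb H i)
    exact (Complex.ext rfl (by simpa using (Complex.le_def.1 h0).2.symm))
  rw [trace, tsum_congr hterm, ← Complex.ofReal_tsum, diagSum, ENNReal.tsum_toReal_eq]
  · congr 1
    exact tsum_congr fun i => (ENNReal.toReal_ofReal (form_nonneg hA _)).symm
  · exact fun _ => ENNReal.ofReal_ne_top

lemma mem_states_iff {ρ : H →L[ℂ] H} : ρ ∈ states H ↔ 0 ≤ ρ ∧ diagSum ρ = 1 := by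
  rw [states, Set.mem_ofPred_eq, ← ContinuousLinearMap.nonneg_iff_isPositive]
  refine and_congr_right fun h0 => ?_
  rw [IsTraceClass, traceNorm_of_nonneg h0]
  constructor
  · rintro ⟨h1, h2⟩
    rw [trace_of_nonneg h0] at h2
    rw [← ENNReal.ofReal_toReal h1.ne, show (diagSum ρ).toReal = 1 by exact_mod_cast h2]
    simp
  · intro h
    refine ⟨by simp [h], ?_⟩
    rw [trace_of_nonneg h0, h]
    simp

lemma convex_states : Convex ℝ (states H) := by
  intro x hx y hy a b ha hb hab
  rw [mem_states_iff] at *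
  have h1 := smul_nonneg ha hx.1
  have h2 := smul_nonneg hb hy.1
  refine ⟨add_nonneg h1 h2, ?_⟩
  rw [diagSum_add h1 h2, diagSum_smul ha, diagSum_smul hb, hx.2, hy.2, mul_one, mul_one,
    ← ENNReal.ofReal_add ha hb, hab, ENNReal.ofReal_one]

/-! ### Trace bounds and finite-dimensionality. -/

lemma ofReal_norm_sq_eq_tsum {ι : Type*} (b : HilbertBasis ι ℂ H) (y : H) :
    ENNReal.ofReal (‖y‖ ^ 2) = ∑' i, ENNReal.ofReal (‖inner ℂ (b i) y‖ ^ 2) := by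
  have h := b.hasSum_inner_mul_inner y y
  have h' : HasSum (fun i => ‖inner ℂ (b i) y‖ ^ 2) (‖y‖ ^ 2) := by
    have h2 := Complex.hasSum_re h
    convert h2 using 1
    · ext i
      rw [← inner_conj_symm y (b i), Complex.conj_mul']
      norm_cast
    · exact (inner_self_eq_norm_sq (𝕜 := ℂ) y).symm
  rw [← h'.tsum_eq, ENNReal.ofReal_tsum_of_nonneg (fun i => by positivity) h'.summable]

/-- The diagonal entries along any finite orthonormal family sum to at most the trace. -/
lemma sum_form_orthonormal_le {A : H →L[ℂ] H} (hA : 0 ≤ A) {ι : Type*} [Fintype ι] {v : ι → H}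
    (hv : Orthonormal ℂ v) : ∑ j, ENNReal.ofReal (form A (v j)) ≤ diagSum A := by
  -- With `A = S * S` the form is `‖S v‖²`: Parseval in `onb H`, exchange of sums, then Bessel for
  -- `v`.
  set S := CFC.sqrt A
  have hS : IsSelfAdjoint S := (CFC.sqrt_nonneg A).isSelfAdjoint
  have hA' : A = S * S := (CFC.sqrt_mul_sqrt_self A hA).symm
  have hsymm : ∀ x y, inner ℂ (S x) y = inner ℂ x (S y) :=
    ContinuousLinearMap.isSelfAdjoint_iff_isSymmetric.1 hS
  rw [hA']
  simp only [diagSum, form_mul_self hS]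
  simp only [ofReal_norm_sq_eq_tsum (onb H) (S (v _))]
  rw [← Summable.tsum_finsetSum (fun _ _ => ENNReal.summable)]
  refine ENNReal.tsum_le_tsum fun i => ?_
  rw [← ENNReal.ofReal_sum_of_nonneg (fun _ _ => by positivity)]
  refine ENNReal.ofReal_le_ofReal ?_
  refine le_trans (le_of_eq ?_) (hv.sum_inner_products_le (s := Finset.univ) (S (onb H i)))
  refine Finset.sum_congr rfl fun j _ => ?_
  rw [← hsymm, norm_inner_symm]

/-- A subspace on which a positive trace-class operator is bounded below is finite-dimensional. -/
lemma finiteDimensional_of_le_form {A : H →L[ℂ] H} (hA : 0 ≤ A) (hT : diagSum A ≠ ∞) {c : ℝ}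
    (hc : 0 < c) (V : Submodule ℂ H) (hV : ∀ x ∈ V, c * ‖x‖ ^ 2 ≤ form A x) :
    FiniteDimensional ℂ V := by
  by_contra hinf
  -- More than `Tr A / c` orthonormal vectors in `V` would exceed the trace.
  obtain ⟨n, hn⟩ := exists_nat_gt ((diagSum A).toReal / c)
  have hrank : (n : Cardinal) ≤ Module.rank ℂ V :=
    (Cardinal.natCast_lt_aleph0).le.trans
      (not_lt.1 fun h => hinf (Module.rank_lt_aleph0_iff.1 h))
  obtain ⟨s, hs, hli⟩ := le_rank_iff_exists_linearIndependent_finset.1 hrank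
  set W := Submodule.span ℂ (s : Set V)
  have hW : Module.finrank ℂ W = n := by
    rw [finrank_span_finset_eq_card hli, hs]
  let w := stdOrthonormalBasis ℂ W
  have hw : Orthonormal ℂ fun j => ((w j : V) : H) :=
    (w.orthonormal.comp_linearIsometry W.subtypeₗᵢ).comp_linearIsometry V.subtypeₗᵢ
  have h1 := sum_form_orthonormal_le hA hw
  have h2 : ∑ _j : Fin (Module.finrank ℂ W), ENNReal.ofReal c ≤ diagSum A := by
    refine le_trans (Finset.sum_le_sum fun j _ => ENNReal.ofReal_le_ofReal ?_) h1
    have := hV _ (w j : V).2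
    rwa [show ‖((w j : V) : H)‖ = 1 from hw.1 j, one_pow, mul_one] at this
  rw [Finset.sum_const, Finset.card_univ, Fintype.card_fin, hW, nsmul_eq_mul] at h2
  have h3 := ENNReal.toReal_mono hT h2
  rw [ENNReal.toReal_mul, ENNReal.toReal_natCast, ENNReal.toReal_ofReal hc.le] at h3
  rw [div_lt_iff₀ hc] at hn
  linarith

/-! ### Spectral cutoff and spans of eigenspaces. -/

/-- The part of a positive operator above the level `c`, i.e. `(A - c)⁺`. -/
def cutoff (A : H →L[ℂ] H) (c : ℝ) : H →L[ℂ] H := cfc (fun x : ℝ => max (x - c) 0) A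

lemma cutoff_nonneg (A : H →L[ℂ] H) (c : ℝ) : 0 ≤ cutoff A c :=
  cfc_nonneg fun _ _ => le_max_right _ _

lemma cutoff_le {A : H →L[ℂ] H} (hA : 0 ≤ A) {c : ℝ} (hc : 0 ≤ c) : cutoff A c ≤ A := by
  conv_rhs => rw [← cfc_id' ℝ A]
  refine cfc_mono fun x hx => ?_
  have := spectrum_nonneg_of_nonneg hA hx
  exact max_le (by linarith) this

lemma le_algebraMap_add_cutoff {A : H →L[ℂ] H} (hA : 0 ≤ A) (c : ℝ) :
    A ≤ algebraMap ℝ (H →L[ℂ] H) c + cutoff A c := by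
  rw [cutoff, ← cfc_const_add c (fun x : ℝ => max (x - c) 0) A]
  conv_lhs => rw [← cfc_id' ℝ A]
  refine cfc_mono fun x _ => ?_
  have := le_max_left (x - c) 0
  linarith

lemma cutoff_commute (A : H →L[ℂ] H) (hA : 0 ≤ A) (c : ℝ) : A * cutoff A c = cutoff A c * A := by
  have := cfc_commute_cfc (fun x : ℝ => x) (fun x : ℝ => max (x - c) 0) A
  rw [cfc_id' ℝ A] at this
  exact this

/-- With `B = (A - c)⁺`, the functional calculus gives `B A B ≥ c B²`. -/
lemma le_form_of_mem_range_cutoff {A : H →L[ℂ] H} (hA : 0 ≤ A) (c : ℝ) {x : H}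
    (hx : x ∈ LinearMap.range (cutoff A c : H →ₗ[ℂ] H)) : c * ‖x‖ ^ 2 ≤ form A x := by
  obtain ⟨y, rfl⟩ := hx
  rw [ContinuousLinearMap.coe_coe]
  set B := cutoff A c with hB
  have hBs : IsSelfAdjoint B := (cutoff_nonneg A c).isSelfAdjoint
  have h1 : form A (B y) = form (B * (A * B)) y := by
    have h := (ContinuousLinearMap.isSelfAdjoint_iff_isSymmetric.1 hBs) y (A (B y))
    exact congrArg Complex.re h
  have h2 : c • (B * B) ≤ B * (A * B) := by
    have e1 : B * (A * B) = cfc (fun x : ℝ => max (x - c) 0 * (x * max (x - c) 0)) A := by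
      rw [cfc_mul (fun x : ℝ => max (x - c) 0) (fun x : ℝ => x * max (x - c) 0) A,
        cfc_mul (fun x : ℝ => x) (fun x : ℝ => max (x - c) 0) A, cfc_id' ℝ A]
      rfl
    have e2 : c • (B * B) = cfc (fun x : ℝ => c * (max (x - c) 0 * max (x - c) 0)) A := by
      rw [cfc_const_mul c (fun x : ℝ => max (x - c) 0 * max (x - c) 0) A,
        cfc_mul (fun x : ℝ => max (x - c) 0) (fun x : ℝ => max (x - c) 0) A]
      rfl
    rw [e1, e2]
    refine cfc_mono fun x _ => ?_
    rcases le_total (x - c) 0 with h | h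
    · simp [max_eq_right h]
    · rw [max_eq_left h]
      nlinarith [mul_nonneg h (mul_nonneg h h)]
  have h3 := form_mono h2 y
  rw [form_smul, form_mul_self hBs] at h3
  rwa [h1]

/-- The span of the eigenspaces of `A` for eigenvalues in `[c, ∞)`. -/
def topSpace (A : H →L[ℂ] H) (c : ℝ) : Submodule ℂ H :=
  ⨆ (ν : ℝ) (_ : c ≤ ν), Module.End.eigenspace (A : H →ₗ[ℂ] H) (ν : ℂ)

/-- Eigenspaces are orthogonal, so the form splits as `∑ ν ‖x_ν‖²` with every `ν ≥ c`. -/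
lemma le_form_of_mem_topSpace {A : H →L[ℂ] H} (hA : 0 ≤ A) (c : ℝ) {x : H}
    (hx : x ∈ topSpace A c) : c * ‖x‖ ^ 2 ≤ form A x := by
  have hsymm : (A : H →ₗ[ℂ] H).IsSymmetric :=
    ContinuousLinearMap.isSelfAdjoint_iff_isSymmetric.1 hA.isSelfAdjoint
  rw [topSpace, iSup_subtype', Submodule.mem_iSup_iff_exists_finsupp] at hx
  obtain ⟨f, hf, rfl⟩ := hx
  have horth : OrthogonalFamily ℂ
      (fun ν : {ν : ℝ // c ≤ ν} => Module.End.eigenspace (A : H →ₗ[ℂ] H) ((ν : ℝ) : ℂ))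
      (fun ν => (Module.End.eigenspace (A : H →ₗ[ℂ] H) ((ν : ℝ) : ℂ)).subtypeₗᵢ) :=
    hsymm.orthogonalFamily_eigenspaces.comp
      (γ := {ν : ℝ // c ≤ ν}) (f := fun ν => ((ν : ℝ) : ℂ))
      (fun a b h => Subtype.ext (Complex.ofReal_injective h))
  let l : ∀ ν : {ν : ℝ // c ≤ ν}, Module.End.eigenspace (A : H →ₗ[ℂ] H) ((ν : ℝ) : ℂ) :=
    fun ν => ⟨f ν, hf ν⟩
  let l' : ∀ ν : {ν : ℝ // c ≤ ν}, Module.End.eigenspace (A : H →ₗ[ℂ] H) ((ν : ℝ) : ℂ) :=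
    fun ν => ((ν : ℝ) : ℂ) • l ν
  have hA' : A (f.sum fun _ x => x) = ∑ ν ∈ f.support, (l' ν : H) := by
    rw [Finsupp.sum, map_sum]
    exact Finset.sum_congr rfl fun ν _ => Module.End.mem_eigenspace_iff.1 (hf ν)
  have h1 := horth.inner_sum l l' f.support
  have h2 := horth.norm_sum l f.support
  simp only [Submodule.coe_subtypeₗᵢ, Submodule.subtype_apply] at h1 h2
  rw [form, hA']
  change c * ‖∑ ν ∈ f.support, (l ν : H)‖ ^ 2 ≤
    (inner ℂ (∑ ν ∈ f.support, (l ν : H)) (∑ ν ∈ f.support, (l' ν : H))).re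
  rw [h1, h2, Finset.mul_sum, Complex.re_sum]
  refine Finset.sum_le_sum fun ν _ => ?_
  have h3 : (inner ℂ (l ν) (l' ν)).re = (ν : ℝ) * ‖l ν‖ ^ 2 := by
    rw [inner_smul_right, Complex.re_ofReal_mul]
    congr 1
    exact inner_self_eq_norm_sq (𝕜 := ℂ) (l ν)
  rw [h3]
  exact mul_le_mul_of_nonneg_right ν.2 (by positivity)

lemma finiteDimensional_range_cutoff {A : H →L[ℂ] H} (hA : 0 ≤ A) (hT : diagSum A ≠ ∞) {c : ℝ}
    (hc : 0 < c) : FiniteDimensional ℂ (LinearMap.range (cutoff A c : H →ₗ[ℂ] H)) :=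
  finiteDimensional_of_le_form hA hT hc _ fun _ => le_form_of_mem_range_cutoff hA c

lemma finiteDimensional_topSpace {A : H →L[ℂ] H} (hA : 0 ≤ A) (hT : diagSum A ≠ ∞) {c : ℝ}
    (hc : 0 < c) : FiniteDimensional ℂ (topSpace A c) :=
  finiteDimensional_of_le_form hA hT hc _ fun _ => le_form_of_mem_topSpace hA c

/-- The range is finite-dimensional and `A`-invariant, so the finite-dimensional spectral theorem
diagonalises `A` on it; the lower bound on the form forces the eigenvalues to be at least `c`. -/
lemma range_cutoff_le_topSpace {A : H →L[ℂ] H} (hA : 0 ≤ A) (hT : diagSum A ≠ ∞) {c : ℝ}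
    (hc : 0 < c) : LinearMap.range (cutoff A c : H →ₗ[ℂ] H) ≤ topSpace A c := by
  set R := LinearMap.range (cutoff A c : H →ₗ[ℂ] H) with hR
  have hfin : FiniteDimensional ℂ R := finiteDimensional_range_cutoff hA hT hc
  have hsymm : (A : H →ₗ[ℂ] H).IsSymmetric :=
    ContinuousLinearMap.isSelfAdjoint_iff_isSymmetric.1 hA.isSelfAdjoint
  have hinv : ∀ x ∈ R, (A : H →ₗ[ℂ] H) x ∈ R := by
    rintro _ ⟨y, rfl⟩
    exact ⟨A y, (DFunLike.congr_fun (cutoff_commute A hA c) y).symm⟩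
  have hTs := hsymm.restrict_invariant hinv
  have htop := (Submodule.orthogonal_eq_bot_iff).1 hTs.orthogonalComplement_iSup_eigenspaces_eq_bot
  have hle : (⨆ μ, Module.End.eigenspace ((A : H →ₗ[ℂ] H).restrict hinv) μ) ≤
      (topSpace A c).comap R.subtype := by
    refine iSup_le fun μ x hx => ?_
    rw [Submodule.mem_comap, Submodule.subtype_apply]
    rcases eq_or_ne x 0 with rfl | hx0
    · simp
    have hx' : A (x : H) = μ • (x : H) :=
      congrArg Subtype.val (Module.End.mem_eigenspace_iff.1 hx)
    have hμ : (starRingEnd ℂ) μ = μ :=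
      hTs.conj_eigenvalue_eq_self (Module.End.hasEigenvalue_of_hasEigenvector ⟨hx, hx0⟩)
    obtain ⟨r, rfl⟩ := Complex.conj_eq_iff_real.1 hμ
    have h1 : form A (x : H) = r * ‖(x : H)‖ ^ 2 := by
      rw [form, hx', inner_smul_right, Complex.re_ofReal_mul]
      congr 1
      exact inner_self_eq_norm_sq (𝕜 := ℂ) (x : H)
    have h2 := le_form_of_mem_range_cutoff hA c x.2
    rw [h1] at h2
    have hpos : 0 < ‖(x : H)‖ ^ 2 := by
      have : (x : H) ≠ 0 := by simpa using hx0
      positivity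
    have hcr : c ≤ r := le_of_mul_le_mul_right h2 hpos
    exact Submodule.mem_iSup_of_mem r (Submodule.mem_iSup_of_mem hcr
      (Module.End.mem_eigenspace_iff.2 hx'))
  rw [htop] at hle
  exact fun x hx => hle (x := ⟨x, hx⟩) Submodule.mem_top

/-- Such an `x` is orthogonal to the range of the self-adjoint `(A - c)⁺`, hence killed by it, and
`A ≤ c + (A - c)⁺`. -/
lemma form_le_of_mem_orthogonal_topSpace {A : H →L[ℂ] H} (hA : 0 ≤ A) (hT : diagSum A ≠ ∞) {c : ℝ}
    (hc : 0 < c) {x : H} (hx : x ∈ (topSpace A c)ᗮ) : form A x ≤ c * ‖x‖ ^ 2 := by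
  have hBs : IsSelfAdjoint (cutoff A c) := (cutoff_nonneg A c).isSelfAdjoint
  have h0 : cutoff A c x = 0 := by
    have h := (ContinuousLinearMap.isSelfAdjoint_iff_isSymmetric.1 hBs) (cutoff A c x) x
    simp only [ContinuousLinearMap.coe_coe] at h
    rw [← inner_self_eq_zero (𝕜 := ℂ), ← h]
    exact (Submodule.mem_orthogonal _ _).1 hx _ (range_cutoff_le_topSpace hA hT hc ⟨_, rfl⟩)
  have h := form_mono (le_algebraMap_add_cutoff hA c) x
  rw [form_add, form_algebraMap] at h
  simpa [form, h0] using h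

/-! ### The eigenvalue sequence and Weyl's inequality. -/

lemma countEigenvaluesGE_eq_rank (A : H →L[ℂ] H) (c : ℝ) :
    countEigenvaluesGE A c = Module.rank ℂ (topSpace A c) := rfl

lemma eigenvalueSeq_nonneg (A : H →L[ℂ] H) (n : ℕ) : 0 ≤ eigenvalueSeq A n :=
  Real.sSup_nonneg fun _ h => h.1.le

lemma bddAbove_eigenvalueSeq_set {A : H →L[ℂ] H} (hA : 0 ≤ A) (n : ℕ) :
    BddAbove {μ : ℝ | 0 < μ ∧ (n : Cardinal) < countEigenvaluesGE A μ} := by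
  refine ⟨‖A‖, fun μ hμ => ?_⟩
  have hne : topSpace A μ ≠ ⊥ := by
    intro h
    have h2 := hμ.2
    rw [countEigenvaluesGE_eq_rank, h, rank_bot] at h2
    exact not_lt_zero h2
  obtain ⟨x, hx, hx0⟩ := Submodule.exists_mem_ne_zero_of_ne_bot hne
  have h1 := le_form_of_mem_topSpace hA μ hx
  have h2 : form A x ≤ ‖A‖ * ‖x‖ ^ 2 := by
    calc form A x ≤ ‖inner ℂ x (A x)‖ := Complex.re_le_norm _
      _ ≤ ‖x‖ * ‖A x‖ := norm_inner_le_norm _ _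
      _ ≤ ‖x‖ * (‖A‖ * ‖x‖) := by gcongr; exact A.le_opNorm x
      _ = ‖A‖ * ‖x‖ ^ 2 := by ring
  exact le_of_mul_le_mul_right (h1.trans h2) (by positivity)

lemma finrank_topSpace_le {A : H →L[ℂ] H} (hA : 0 ≤ A) (hT : diagSum A ≠ ∞) {c : ℝ}
    (hc : 0 < c) {n : ℕ} (h : eigenvalueSeq A n < c) : Module.finrank ℂ (topSpace A c) ≤ n := by
  have := finiteDimensional_topSpace hA hT hc
  by_contra! hlt
  refine h.not_ge (le_csSup (bddAbove_eigenvalueSeq_set hA n) ⟨hc, ?_⟩)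
  rw [countEigenvaluesGE_eq_rank, ← Module.finrank_eq_rank]
  exact_mod_cast hlt

/-- A vector of a large subspace orthogonal to two given smaller ones. -/
lemma exists_mem_orthogonal_of_finrank_lt (V W₁ W₂ : Submodule ℂ H) [FiniteDimensional ℂ V]
    [FiniteDimensional ℂ W₁] [FiniteDimensional ℂ W₂]
    (h : Module.finrank ℂ W₁ + Module.finrank ℂ W₂ < Module.finrank ℂ V) :
    ∃ x ∈ V, x ≠ 0 ∧ x ∈ W₁ᗮ ∧ x ∈ W₂ᗮ := by
  let f : V →ₗ[ℂ] W₁ × W₂ :=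
    ((W₁.orthogonalProjectionOnto : H →ₗ[ℂ] W₁).prod (W₂.orthogonalProjectionOnto : H →ₗ[ℂ] W₂)).comp
      V.subtype
  have hf : LinearMap.ker f ≠ ⊥ :=
    LinearMap.ker_ne_bot_of_finrank_lt (by rwa [Module.finrank_prod])
  obtain ⟨x, hx, hx0⟩ := Submodule.exists_mem_ne_zero_of_ne_bot hf
  have hx' : (W₁.orthogonalProjectionOnto (x : H), W₂.orthogonalProjectionOnto (x : H)) = 0 := hx
  rw [Prod.mk_eq_zero] at hx'
  exact ⟨x, x.2, by simpa using hx0, Submodule.orthogonalProjectionOnto_eq_zero_iff.1 hx'.1,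
    Submodule.orthogonalProjectionOnto_eq_zero_iff.1 hx'.2⟩

/-- Weyl's inequality for the eigenvalues of positive trace-class operators. -/
theorem eigenvalueSeq_le_of_form_le {A B C : H →L[ℂ] H} (hA : 0 ≤ A) (hB : 0 ≤ B) (hC : 0 ≤ C)
    (hA' : diagSum A ≠ ∞) (hB' : diagSum B ≠ ∞) (hC' : diagSum C ≠ ∞) {a b : ℝ} (ha : 0 ≤ a)
    (hb : 0 ≤ b) (h : ∀ x, form A x ≤ a * form B x + b * form C x) {i j n : ℕ} (hn : i + j ≤ n) :
    eigenvalueSeq A n ≤ a * eigenvalueSeq B i + b * eigenvalueSeq C j := by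
  -- The slack `δ` puts the levels for `B` and `C` above zero and strictly above the eigenvalues, so
  -- their top spaces have dimension at most `i` and `j`.
  have key : ∀ δ > 0, eigenvalueSeq A n ≤
      a * (eigenvalueSeq B i + δ) + b * (eigenvalueSeq C j + δ) := by
    intro δ hδ
    have hBi := eigenvalueSeq_nonneg B i
    have hCj := eigenvalueSeq_nonneg C j
    refine Real.sSup_le ?_ (by positivity)
    rintro μ ⟨hμ, hcount⟩
    have hc₁ : 0 < eigenvalueSeq B i + δ := by positivity
    have hc₂ : 0 < eigenvalueSeq C j + δ := by positivity
    have := finiteDimensional_topSpace hA hA' hμ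
    have := finiteDimensional_topSpace hB hB' hc₁
    have := finiteDimensional_topSpace hC hC' hc₂
    rw [countEigenvaluesGE_eq_rank, ← Module.finrank_eq_rank] at hcount
    have hcount' : n < Module.finrank ℂ (topSpace A μ) := by exact_mod_cast hcount
    have h1 := finrank_topSpace_le hB hB' hc₁ (lt_add_of_pos_right _ hδ)
    have h2 := finrank_topSpace_le hC hC' hc₂ (lt_add_of_pos_right _ hδ)
    obtain ⟨x, hxV, hx0, hx1, hx2⟩ := exists_mem_orthogonal_of_finrank_lt (topSpace A μ)
      (topSpace B (eigenvalueSeq B i + δ)) (topSpace C (eigenvalueSeq C j + δ)) (by omega)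
    have e1 := mul_le_mul_of_nonneg_left (form_le_of_mem_orthogonal_topSpace hB hB' hc₁ hx1) ha
    have e2 := mul_le_mul_of_nonneg_left (form_le_of_mem_orthogonal_topSpace hC hC' hc₂ hx2) hb
    have e3 := le_form_of_mem_topSpace hA μ hxV
    have hpos : 0 < ‖x‖ ^ 2 := by positivity
    refine le_of_mul_le_mul_right ?_ hpos
    linarith [h x]
  refine le_of_forall_pos_le_add fun ε hε => ?_
  -- The `+ 1` covers the case `a = b = 0`.
  have h1 := key (ε / (a + b + 1)) (by positivity)
  have h2 : (a + b) * (ε / (a + b + 1)) ≤ ε := by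
    rw [← mul_div_assoc, div_le_iff₀ (by positivity)]
    nlinarith
  linarith

/-! ### Limits of exponential sums. -/

/-- The sum of exponentials appearing in the FA-property. -/
def expSum (g : ℕ → ℝ) (β : ℝ) : ℝ≥0∞ := ∑' i, ENNReal.ofReal (Real.exp (-β * g i))

/-- The lower bound in the FA-property is automatic. -/
lemma tendsto_expSum_rpow_of_le {g : ℕ → ℝ} {F : ℝ → ℝ≥0∞} (hF : Tendsto F (𝓝[>] 0) (𝓝 1))
    (h : ∀ᶠ β in 𝓝[>] 0, expSum g β ^ β ≤ F β) :
    Tendsto (fun β : ℝ => expSum g β ^ β) (𝓝[>] 0) (𝓝 1) := by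
  -- The term of index 0 alone already has `β`-th power tending to 1.
  have hlow : Tendsto (fun β : ℝ => ENNReal.ofReal (Real.exp (-β * g 0 * β))) (𝓝[>] 0) (𝓝 1) := by
    have hc : Continuous fun β : ℝ => ENNReal.ofReal (Real.exp (-β * g 0 * β)) :=
      ENNReal.continuous_ofReal.comp (by fun_prop)
    have := hc.tendsto 0
    simp only [mul_zero, Real.exp_zero, ENNReal.ofReal_one] at this
    exact this.mono_left nhdsWithin_le_nhds
  refine tendsto_of_tendsto_of_tendsto_of_le_of_le' hlow hF ?_ h
  filter_upwards [self_mem_nhdsWithin] with β hβ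
  rw [Real.exp_mul, ← ENNReal.ofReal_rpow_of_pos (Real.exp_pos _)]
  exact ENNReal.rpow_le_rpow (ENNReal.le_tsum 0) (le_of_lt hβ)

lemma tendsto_const_rpow (c : ℝ≥0∞) (h0 : c ≠ 0) (h1 : c ≠ ∞) :
    Tendsto (fun β : ℝ => c ^ β) (𝓝[>] 0) (𝓝 1) := by
  have hc : 0 < c.toReal := ENNReal.toReal_pos h0 h1
  have h : Tendsto (fun β : ℝ => ENNReal.ofReal (c.toReal ^ β)) (𝓝 0) (𝓝 1) := by
    have hcont : Continuous fun β : ℝ => ENNReal.ofReal (c.toReal ^ β) :=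
      ENNReal.continuous_ofReal.comp (Real.continuous_const_rpow hc.ne')
    simpa using hcont.tendsto 0
  refine (h.mono_left nhdsWithin_le_nhds).congr fun β => ?_
  rw [← ENNReal.ofReal_rpow_of_pos hc, ENNReal.ofReal_toReal h1]

lemma tsum_div_two (f : ℕ → ℝ≥0∞) : ∑' k, f (k / 2) = 2 * ∑' k, f k := by
  rw [← tsum_even_add_odd ENNReal.summable ENNReal.summable, two_mul]
  congr 1
  · exact tsum_congr fun k => by rw [Nat.mul_div_cancel_left k two_pos]
  · exact tsum_congr fun k => by congr 1; omega

lemma summable_div_two {f : ℕ → ℝ} (hf : Summable f) : Summable fun k => f (k / 2) := by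
  have h : HasSum (fun k => f (k / 2)) (∑' k, f k + ∑' k, f k) := by
    refine HasSum.even_add_odd ?_ ?_
    · simpa using hf.hasSum
    · convert hf.hasSum using 2 with k
      congr 1; omega
  exact h.summable

/-- The exponential of a minimum is at most the sum of both exponentials, and halving the index
doubles each sum. -/
lemma expSum_min_le (g g' : ℕ → ℝ) (β : ℝ) :
    expSum (fun k => min (g (k / 2)) (g' (k / 2))) β ≤ 4 * max (expSum g β) (expSum g' β) := by
  have h1 : ∀ k : ℕ, ENNReal.ofReal (Real.exp (-β * min (g (k / 2)) (g' (k / 2)))) ≤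
      ENNReal.ofReal (Real.exp (-β * g (k / 2))) + ENNReal.ofReal (Real.exp (-β * g' (k / 2))) := by
    intro k
    rcases min_choice (g (k / 2)) (g' (k / 2)) with h | h <;> rw [h]
    · exact le_self_add
    · exact le_add_self
  calc expSum (fun k => min (g (k / 2)) (g' (k / 2))) β
      ≤ ∑' k : ℕ, (ENNReal.ofReal (Real.exp (-β * g (k / 2))) +
          ENNReal.ofReal (Real.exp (-β * g' (k / 2)))) := ENNReal.tsum_le_tsum h1
    _ = 2 * expSum g β + 2 * expSum g' β := by
        rw [ENNReal.tsum_add, tsum_div_two fun k => ENNReal.ofReal (Real.exp (-β * g k)),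
          tsum_div_two fun k => ENNReal.ofReal (Real.exp (-β * g' k))]
        rfl
    _ ≤ 2 * max (expSum g β) (expSum g' β) + 2 * max (expSum g β) (expSum g' β) := by
        gcongr
        · exact le_max_left _ _
        · exact le_max_right _ _
    _ = 4 * max (expSum g β) (expSum g' β) := by rw [← add_mul]; norm_num

lemma tendsto_expSum_min {g g' : ℕ → ℝ}
    (hg : Tendsto (fun β : ℝ => expSum g β ^ β) (𝓝[>] 0) (𝓝 1))
    (hg' : Tendsto (fun β : ℝ => expSum g' β ^ β) (𝓝[>] 0) (𝓝 1)) :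
    Tendsto (fun β : ℝ => expSum (fun k => min (g (k / 2)) (g' (k / 2))) β ^ β)
      (𝓝[>] 0) (𝓝 1) := by
  have hF := ENNReal.Tendsto.mul (tendsto_const_rpow 4 (by norm_num) (by norm_num)) (by simp)
    (hg.max hg') (by simp)
  rw [max_self, mul_one] at hF
  refine tendsto_expSum_rpow_of_le hF ?_
  filter_upwards [self_mem_nhdsWithin] with β hβ
  refine (ENNReal.rpow_le_rpow (expSum_min_le g g' β) (le_of_lt hβ)).trans (le_of_eq ?_)
  rw [ENNReal.mul_rpow_of_nonneg _ _ (le_of_lt hβ),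
    (ENNReal.monotone_rpow_of_nonneg (le_of_lt hβ)).map_max]

/-- The geometric series is at most `2 / β` for `β < 1`, and `(2 / β)^β → 1` because `β log β → 0`.
-/
lemma tendsto_expSum_natCast :
    Tendsto (fun β : ℝ => expSum (fun i => (i : ℝ)) β ^ β) (𝓝[>] 0) (𝓝 1) := by
  have hF : Tendsto (fun β : ℝ => ENNReal.ofReal (2 ^ β * (Real.exp (Real.log β * β))⁻¹))
      (𝓝[>] 0) (𝓝 1) := by
    have h1 : Tendsto (fun β : ℝ => (2 : ℝ) ^ β) (𝓝[>] 0) (𝓝 1) := by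
      have := (Real.continuous_const_rpow (a := 2) two_ne_zero).tendsto 0
      rw [Real.rpow_zero] at this
      exact this.mono_left nhdsWithin_le_nhds
    have h2 : Tendsto (fun β : ℝ => Real.log β * β) (𝓝[>] 0) (𝓝 0) := by
      have := Real.continuous_mul_log.tendsto 0
      simp only [zero_mul] at this
      exact (this.mono_left nhdsWithin_le_nhds).congr fun β => mul_comm _ _
    have h3 := h1.mul (((Real.continuous_exp.tendsto 0).comp h2).inv₀ (by simp))
    rw [Real.exp_zero, inv_one, mul_one] at h3
    have h4 := (ENNReal.continuous_ofReal.tendsto 1).comp h3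
    rw [ENNReal.ofReal_one] at h4
    exact h4
  refine tendsto_expSum_rpow_of_le hF ?_
  have hlt : ∀ᶠ β : ℝ in 𝓝[>] 0, β < 1 :=
    nhdsWithin_le_nhds (gt_mem_nhds one_pos)
  filter_upwards [self_mem_nhdsWithin, hlt] with β hβ hβ1
  have hβ0 : 0 < β := hβ
  have hsum : expSum (fun i => (i : ℝ)) β = ENNReal.ofReal (1 - Real.exp (-β))⁻¹ := by
    have hr : Real.exp (-β) < 1 := by simpa using hβ0
    have h := hasSum_geometric_of_lt_one (Real.exp_pos (-β)).le hr
    rw [← h.tsum_eq, ENNReal.ofReal_tsum_of_nonneg (fun n => by positivity) h.summable]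
    refine tsum_congr fun i => ?_
    rw [← Real.exp_nat_mul, mul_comm]
  have hle : (1 - Real.exp (-β))⁻¹ ≤ 2 / β := by
    have h1 : Real.exp (-β) * (1 + β) ≤ 1 := by
      rw [Real.exp_neg, inv_mul_le_iff₀ (Real.exp_pos _), mul_one]
      linarith [Real.add_one_le_exp β]
    have h2 : β / 2 ≤ 1 - Real.exp (-β) := by
      have : Real.exp (-β) ≤ 1 - β / 2 := by
        -- For `0 < β < 1` one has `(1 - β/2)(1 + β) > 1`, against `h1`.
        by_contra! hcon
        nlinarith
      linarith
    rw [← inv_div]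
    exact inv_anti₀ (by positivity) h2
  have hpos : 0 < 2 / β := by positivity
  rw [hsum]
  refine (ENNReal.rpow_le_rpow (ENNReal.ofReal_le_ofReal hle) hβ0.le).trans (le_of_eq ?_)
  rw [ENNReal.ofReal_rpow_of_pos hpos, Real.div_rpow zero_le_two hβ0.le,
    Real.rpow_def_of_pos hβ0, div_eq_mul_inv]

/-! ### The face property. -/

lemma diagSum_ne_top_of_mem_states {ρ : H →L[ℂ] H} (h : ρ ∈ states H) : diagSum ρ ≠ ∞ := by
  rw [(mem_states_iff.1 h).2]
  exact ENNReal.one_ne_top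

lemma convex_statesFA : Convex ℝ (statesFA H) := by
  rintro x ⟨hx, g, hg0, hgs, hgt⟩ y ⟨hy, g', hg0', hgs', hgt'⟩ a b ha hb hab
  have hz := convex_states hx hy ha hb hab
  refine ⟨hz, fun k => min (g (k / 2)) (g' (k / 2)), fun k => le_min (hg0 _) (hg0' _), ?_,
    tendsto_expSum_min hgt hgt'⟩
  refine Summable.of_nonneg_of_le
    (fun k => mul_nonneg (eigenvalueSeq_nonneg _ _) (le_min (hg0 _) (hg0' _))) (fun k => ?_)
    (summable_div_two ((hgs.mul_left a).add (hgs'.mul_left b)))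
  have hw := eigenvalueSeq_le_of_form_le (mem_states_iff.1 hz).1 (mem_states_iff.1 hx).1
    (mem_states_iff.1 hy).1 (diagSum_ne_top_of_mem_states hz) (diagSum_ne_top_of_mem_states hx)
    (diagSum_ne_top_of_mem_states hy) ha hb
    (fun v => by rw [form_add, form_smul, form_smul]) (i := k / 2) (j := k / 2) (n := k) (by omega)
  have hx0 := mul_nonneg ha (eigenvalueSeq_nonneg x (k / 2))
  have hy0 := mul_nonneg hb (eigenvalueSeq_nonneg y (k / 2))
  have hmin : 0 ≤ min (g (k / 2)) (g' (k / 2)) := le_min (hg0 _) (hg0' _)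
  calc eigenvalueSeq (a • x + b • y) k * min (g (k / 2)) (g' (k / 2))
      ≤ (a * eigenvalueSeq x (k / 2) + b * eigenvalueSeq y (k / 2)) *
          min (g (k / 2)) (g' (k / 2)) := mul_le_mul_of_nonneg_right hw hmin
    _ = a * eigenvalueSeq x (k / 2) * min (g (k / 2)) (g' (k / 2)) +
          b * eigenvalueSeq y (k / 2) * min (g (k / 2)) (g' (k / 2)) := add_mul _ _ _
    _ ≤ a * eigenvalueSeq x (k / 2) * g (k / 2) + b * eigenvalueSeq y (k / 2) * g' (k / 2) :=
        add_le_add (mul_le_mul_of_nonneg_left (min_le_left _ _) hx0)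
          (mul_le_mul_of_nonneg_left (min_le_right _ _) hy0)
    _ = a * (eigenvalueSeq x (k / 2) * g (k / 2)) +
          b * (eigenvalueSeq y (k / 2) * g' (k / 2)) := by ring

/-- A state dominated by a multiple of a state with the FA-property has the FA-property. -/
lemma mem_statesFA_of_smul_le {x z : H →L[ℂ] H} (hx : x ∈ states H) (hz : z ∈ statesFA H) {a : ℝ}
    (ha : 0 < a) (h : a • x ≤ z) : x ∈ statesFA H := by
  obtain ⟨hz, g, hg0, hgs, hgt⟩ := hz
  refine ⟨hx, g, hg0, ?_, hgt⟩
  refine Summable.of_nonneg_of_le (fun k => mul_nonneg (eigenvalueSeq_nonneg _ _) (hg0 _))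
    (fun k => ?_) (hgs.mul_left a⁻¹)
  have hz0 := (mem_states_iff.1 hz).1
  have hzT := diagSum_ne_top_of_mem_states hz
  -- Weyl's inequality with second coefficient 0 is monotonicity of eigenvalues; the third operator
  -- is a dummy.
  have hw := eigenvalueSeq_le_of_form_le (mem_states_iff.1 hx).1 hz0 hz0
    (diagSum_ne_top_of_mem_states hx) hzT hzT (inv_nonneg.2 ha.le) le_rfl
    (fun v => by
      have := form_mono h v
      rw [form_smul] at this
      rw [zero_mul, add_zero, le_inv_mul_iff₀ ha]
      exact this) (i := k) (j := 0) (n := k) (by omega)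
  rw [zero_mul, add_zero] at hw
  rw [← mul_assoc]
  exact mul_le_mul_of_nonneg_right hw (hg0 k)

lemma isFace_statesFA : IsFace (states H) (statesFA H) where
  convex_ambient := convex_states
  subset := fun _ h => h.1
  convex := convex_statesFA
  segment_subset := by
    rintro x hx y hy ⟨z, ⟨a, b, ha, hb, -, rfl⟩, hz⟩
    refine convex_statesFA.segment_subset ?_ ?_
    · exact mem_statesFA_of_smul_le hx hz ha
        (le_add_of_nonneg_right (smul_nonneg hb.le (mem_states_iff.1 hy).1))
    · exact mem_statesFA_of_smul_le hy hz hb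
        (le_add_of_nonneg_left (smul_nonneg ha.le (mem_states_iff.1 hx).1))

/-! ### Density by finite-rank truncation. -/

/-- Dominated convergence: the diagonal entries of `A - (A - c)⁺` are at most `c` and at most those
of `A`. -/
lemma exists_diagSum_sub_cutoff_lt {A : H →L[ℂ] H} (hA : 0 ≤ A) (hT : diagSum A ≠ ∞) {η : ℝ≥0∞}
    (hη : 0 < η) : ∃ c > 0, diagSum (A - cutoff A c) < η := by
  have hpos : ∀ n : ℕ, (0 : ℝ) < 1 / ((n : ℝ) + 1) := fun n => by positivity
  have hsub : ∀ n : ℕ, 0 ≤ A - cutoff A (1 / ((n : ℝ) + 1)) := fun n =>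
    sub_nonneg.2 (cutoff_le hA (hpos n).le)
  have hle : ∀ (n : ℕ) i, form (A - cutoff A (1 / ((n : ℝ) + 1))) (onb H i) ≤
      form A (onb H i) := fun n i => by
    have := form_nonneg (cutoff_nonneg A (1 / ((n : ℝ) + 1))) (onb H i)
    rw [form_sub]
    linarith
  have hle' : ∀ (n : ℕ) i, form (A - cutoff A (1 / ((n : ℝ) + 1))) (onb H i) ≤
      1 / ((n : ℝ) + 1) := fun n i => by
    have := form_mono (le_algebraMap_add_cutoff hA (1 / ((n : ℝ) + 1))) (onb H i)
    rw [form_add, form_algebraMap, (onb H).orthonormal.1 i] at this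
    rw [form_sub]
    linarith
  have hsum : Summable fun i => form A (onb H i) :=
    (ENNReal.summable_toReal hT).congr fun i => ENNReal.toReal_ofReal (form_nonneg hA _)
  have hlim := tendsto_tsum_of_dominated_convergence (𝓕 := atTop)
    (f := fun (n : ℕ) i => form (A - cutoff A (1 / ((n : ℝ) + 1))) (onb H i))
    (g := fun _ => 0) hsum
    (fun i => squeeze_zero (fun n => form_nonneg (hsub n) _) (fun n => hle' n i)
      tendsto_one_div_add_atTop_nhds_zero_nat)
    (Eventually.of_forall fun n i => by
      rw [Real.norm_of_nonneg (form_nonneg (hsub n) _)]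
      exact hle n i)
  rw [tsum_zero] at hlim
  have hlim' := (ENNReal.continuous_ofReal.tendsto 0).comp hlim
  rw [ENNReal.ofReal_zero] at hlim'
  obtain ⟨n, hn⟩ := (hlim'.eventually (gt_mem_nhds hη)).exists
  refine ⟨_, hpos n, ?_⟩
  rwa [Function.comp_apply, ENNReal.ofReal_tsum_of_nonneg (fun i => form_nonneg (hsub n) _)
    (Summable.of_nonneg_of_le (fun i => form_nonneg (hsub n) _) (hle n) hsum)] at hn

lemma topSpace_smul_le_range (B : H →L[ℂ] H) (s : ℝ) {μ : ℝ} (hμ : 0 < μ) :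
    topSpace (s • B) μ ≤ LinearMap.range (B : H →ₗ[ℂ] H) := by
  refine iSup₂_le fun ν hν x hx => ?_
  have hν0 : (ν : ℂ) ≠ 0 := by exact_mod_cast (hμ.trans_le hν).ne'
  have hx' : (s : ℂ) • B x = (ν : ℂ) • x := Module.End.mem_eigenspace_iff.1 hx
  refine ⟨((ν : ℂ)⁻¹ * s) • x, ?_⟩
  rw [map_smul, mul_smul, ContinuousLinearMap.coe_coe, hx', smul_smul, inv_mul_cancel₀ hν0,
    one_smul]

lemma hasFAProperty_smul_of_finiteDimensional_range (B : H →L[ℂ] H) (s : ℝ)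
    [FiniteDimensional ℂ (LinearMap.range (B : H →ₗ[ℂ] H))] : HasFAProperty (s • B) := by
  refine ⟨fun i => i, fun i => Nat.cast_nonneg i, ?_, tendsto_expSum_natCast⟩
  refine summable_of_ne_finset_zero
    (s := Finset.range (Module.finrank ℂ (LinearMap.range (B : H →ₗ[ℂ] H)))) fun n hn => ?_
  -- Beyond the rank the supremum is over the empty set, so the eigenvalue is 0.
  have hempty : {μ : ℝ | 0 < μ ∧ (n : Cardinal) < countEigenvaluesGE (s • B) μ} = ∅ := by
    refine Set.eq_empty_of_forall_notMem ?_
    rintro μ ⟨hμ, h⟩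
    have h2 := h.trans_le (Submodule.rank_mono (topSpace_smul_le_range B s hμ))
    rw [← Module.finrank_eq_rank] at h2
    exact hn (Finset.mem_range.2 (by exact_mod_cast h2))
  rw [eigenvalueSeq, hempty, Real.sSup_empty, zero_mul]

/-- On the spectrum, with `m = max (x - c) 0 ≤ x`, this is the triangle inequality `|x - s m| ≤ (x -
m) + (s - 1) m`. -/
lemma abs_sub_smul_cutoff_le {A : H →L[ℂ] H} (hA : 0 ≤ A) {c : ℝ} (hc : 0 ≤ c) {s : ℝ}
    (hs : 1 ≤ s) : CFC.abs (A - s • cutoff A c) ≤ (A - cutoff A c) + (s - 1) • cutoff A c := by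
  have e1 : A - s • cutoff A c = cfc (fun x : ℝ => x - s * max (x - c) 0) A := by
    rw [cfc_sub (fun x : ℝ => x) (fun x : ℝ => s * max (x - c) 0) A, cfc_id' ℝ A,
      cfc_const_mul s (fun x : ℝ => max (x - c) 0) A]
    rfl
  have e2 : (A - cutoff A c) + (s - 1) • cutoff A c =
      cfc (fun x : ℝ => (x - max (x - c) 0) + (s - 1) * max (x - c) 0) A := by
    rw [cfc_add A (fun x : ℝ => x - max (x - c) 0) (fun x : ℝ => (s - 1) * max (x - c) 0),
      cfc_sub (fun x : ℝ => x) (fun x : ℝ => max (x - c) 0) A, cfc_id' ℝ A,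
      cfc_const_mul (s - 1) (fun x : ℝ => max (x - c) 0) A]
    rfl
  have hsa : IsSelfAdjoint (A - s • cutoff A c) := by
    rw [e1]
    exact cfc_predicate _ _
  rw [CFC.abs_eq_cfc_norm _ hsa, e1, ← cfc_comp' (fun x : ℝ => ‖x‖) _ A, e2]
  refine cfc_mono fun x hx => ?_
  have hx0 : 0 ≤ x := spectrum_nonneg_of_nonneg hA hx
  have h1 : 0 ≤ x - max (x - c) 0 := sub_nonneg.2 (max_le (by linarith) hx0)
  have h2 : 0 ≤ (s - 1) * max (x - c) 0 :=
    mul_nonneg (by linarith) (le_max_right _ _)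
  rw [Real.norm_eq_abs, abs_le]
  constructor <;> linarith

lemma isTraceNormDense_statesFA : IsTraceNormDense (states H) (statesFA H) := by
  refine ⟨fun _ h => h.1, fun ρ hρ ε hε => ?_⟩
  obtain ⟨hρ0, hρ1⟩ := mem_states_iff.1 hρ
  have hT := diagSum_ne_top_of_mem_states hρ
  obtain ⟨c, hc, hd⟩ := exists_diagSum_sub_cutoff_lt hρ0 hT
    -- The bound 1 keeps `Tr C` positive, so that `C` can be normalised; `ε / 2` is used twice.
    (lt_min (ENNReal.half_pos hε.ne') one_pos)
  set C := cutoff ρ c with hC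
  have hC0 : 0 ≤ C := cutoff_nonneg ρ c
  have hR0 : 0 ≤ ρ - C := sub_nonneg.2 (cutoff_le hρ0 hc.le)
  have hsplit : diagSum (ρ - C) + diagSum C = 1 := by
    rw [← diagSum_add hR0 hC0, sub_add_cancel, hρ1]
  have hTC : diagSum C ≠ ∞ := ne_top_of_le_ne_top hT (diagSum_mono (cutoff_le hρ0 hc.le))
  have hTC0 : diagSum C ≠ 0 := by
    intro h
    rw [h, add_zero] at hsplit
    exact (hd.trans_le (min_le_right _ _)).ne hsplit
  set t := (diagSum C).toReal with ht
  have ht0 : 0 < t := ENNReal.toReal_pos hTC0 hTC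
  have hTt : diagSum C = ENNReal.ofReal t := (ENNReal.ofReal_toReal hTC).symm
  have ht1 : t ≤ 1 := by
    rw [← ENNReal.ofReal_le_one, ← hTt, ← hsplit]
    exact le_add_self
  have hs : 1 ≤ t⁻¹ := (one_le_inv₀ ht0).2 ht1
  have hfin : FiniteDimensional ℂ (LinearMap.range (C : H →ₗ[ℂ] H)) :=
    finiteDimensional_range_cutoff hρ0 hT hc
  refine ⟨t⁻¹ • C, ⟨mem_states_iff.2 ⟨smul_nonneg (inv_nonneg.2 ht0.le) hC0, ?_⟩,
    hasFAProperty_smul_of_finiteDimensional_range C t⁻¹⟩, ?_⟩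
  · rw [diagSum_smul (inv_nonneg.2 ht0.le), hTt, ← ENNReal.ofReal_mul (inv_nonneg.2 ht0.le),
      inv_mul_cancel₀ ht0.ne', ENNReal.ofReal_one]
  -- Rescaling adds back exactly the trace that truncation removed.
  have hrest : ENNReal.ofReal (t⁻¹ - 1) * diagSum C = diagSum (ρ - C) := by
    have h1 : ENNReal.ofReal (t⁻¹ - 1) * diagSum C + diagSum C =
        diagSum (ρ - C) + diagSum C := by
      rw [hsplit, hTt, ← ENNReal.ofReal_mul (by linarith),
        ← ENNReal.ofReal_add (mul_nonneg (by linarith) ht0.le) ht0.le, sub_mul,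
        inv_mul_cancel₀ ht0.ne', one_mul, sub_add_cancel, ENNReal.ofReal_one]
    exact (ENNReal.add_left_inj hTC).1 h1
  calc traceNorm (ρ - t⁻¹ • C) = diagSum (CFC.abs (ρ - t⁻¹ • C)) := rfl
    _ ≤ diagSum ((ρ - C) + (t⁻¹ - 1) • C) :=
        diagSum_mono (abs_sub_smul_cutoff_le hρ0 hc.le hs)
    _ = diagSum (ρ - C) + diagSum (ρ - C) := by
        rw [diagSum_add hR0 (smul_nonneg (by linarith) hC0), diagSum_smul (by linarith), hrest]
    _ < ε / 2 + ε / 2 := by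
        have := hd.trans_le (min_le_left _ _)
        exact ENNReal.add_lt_add this this
    _ = ε := ENNReal.add_halves ε

end QuantumState

end

/-- The states with the FA-property form a dense face of the set of all states. -/
theorem corollary3 (H : Type*) [NormedAddCommGroup H] [InnerProductSpace ℂ H] [CompleteSpace H]
    [TopologicalSpace.SeparableSpace H] :
    QuantumState.IsFace (QuantumState.states H) (QuantumState.statesFA H) ∧
      QuantumState.IsTraceNormDense (QuantumState.states H) (QuantumState.statesFA H) :=
  ⟨QuantumState.isFace_statesFA, QuantumState.isTraceNormDense_statesFA⟩
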